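/- **Conventions.** Rational functions have complex coefficients and are regarded as maps of the Riemann sphere $\mathbb{CP}^1$ to itself. An orbifold $\mathcal O$ (on $\mathbb{CP}^1$) is given by a ramification function $\nu:\mathbb{CP}^1\to\{1,2,3,\dots\}\cup\{\infty\}$ with $\nu(z)=1$ for all but finitely many $z$; its signature is the collection, with repetition, of the values $\nu(z)>1$. A nonconstant rational function $f$ is a covering map $f:\mathcal O_1\to\mathcal O_2$ between orbifolds with ramification functions $\nu_1,\nu_2$ if $\nu_2(f(z))=\nu_1(z)\deg_z f$ for all $z\in\mathbb{CP}^1$, where $\deg_z f$ is the local degree of $f$ at $z$. A Lattès map is a rational function $f$ of degree at least two for which there is an orbifold $\mathcal O$ of signature $(2,2,2,2)$, $(3,3,3)$, $(2,4,4)$ or $(2,3,6)$ such that $f:\mathcal O\to\mathcal O$ is a covering map. For a Lattès map $f$, the orbifold $\mathcal O$ such that $f:\mathcal O\to\mathcal O$ is a covering map is unique; it is denoted by $\mathcal O_f$, and $l(f)$ denotes the least common multiple of the numbers in its signature. A rational function $V\circ U$ is an elementary transformation of a rational function $A$ if $A=U\circ V$ with rational functions $U,V$; we write $B\sim A$ if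 there is a chain of elementary transformations between $B$ and $A$. **Lemma.** Let $A$ be a Lattès map of degree $d$ with $l(A)=2$, and let $B$ be a rational function such that $B\sim A$. Then $B$ is a Lattès map with $l(B)=2$ (here the uniqueness of the orbifold $\mathcal O_B$ is part of the claim), and there exist a rational function $T$ and an integer $k\ge 0$ such that $\deg T$ divides $d^k$ and $T:\mathcal O_A\to\mathcal O_B$ is a covering map. -/

import Mathlib

open scoped Polynomial OnePoint

noncomputable section

namespace LattesMap

/-- The Riemann sphere, as the one-point compactification of the complex plane. -/
abbrev Sphere : Type := OnePoint ℂ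

/-- The degree of a rational function `P / Q` in lowest terms: `max (deg P) (deg Q)`. -/
def degree (f : RatFunc ℂ) : ℕ := max f.num.natDegree f.denom.natDegree

open Classical in
/-- The self-map of the Riemann sphere given by a rational function `P / Q` in lowest terms.
At the point `∞` one divides numerator and denominator by `z ^ deg f` and lets `z → ∞`. -/
def toMap (f : RatFunc ℂ) : Sphere → Sphere
  | some z => if f.denom.eval z = 0 then ∞ else ((f.num.eval z / f.denom.eval z : ℂ) : Sphere)
  | none =>
      if f.denom.coeff (degree f) = 0 then ∞
      else ((f.num.coeff (degree f) / f.denom.coeff (degree f) : ℂ) : Sphere)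

/-- The polynomial whose roots are the finite solutions of `f z = w`, with multiplicity:
`P - w Q` for finite `w`, and `Q` for `w = ∞`, where `f = P / Q` in lowest terms. -/
def fiberPoly (f : RatFunc ℂ) : Sphere → ℂ[X]
  | some w => f.num - Polynomial.C w * f.denom
  | none => f.denom

/-- The local degree of a nonconstant rational function `f` at the point `z` of the sphere,
that is, the multiplicity of `z` as a solution of the equation `f = f(z)`.
At `z = ∞` this is what the finite solutions leave of the total number `deg f`. -/
def localDegree (f : RatFunc ℂ) : Sphere → ℕ
  | some z => (fiberPoly f (toMap f (z : Sphere))).rootMultiplicity z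
  | none => degree f - (fiberPoly f (toMap f ∞)).natDegree

/-- An orbifold on the Riemann sphere: a ramification function with values in
`{1, 2, 3, …} ∪ {∞}` that is equal to `1` except at isolated points (on the compact sphere:
except at finitely many points). -/
@[ext]
structure Orbifold where
  ν : Sphere → ℕ∞
  one_le : ∀ z, 1 ≤ ν z
  finite_singular : {z | 1 < ν z}.Finite

/-- The signature of an orbifold: the values of the ramification function at the singular
points, listed with repetition. -/
def Orbifold.signature (O : Orbifold) : Multiset ℕ∞ :=
  O.finite_singular.toFinset.val.map O.ν

/-- The least common multiple of the numbers in the signature. (If the value `∞` occurs in the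
signature, this number is `0`; for the signatures of Lattès maps all values are finite.) -/
def Orbifold.l (O : Orbifold) : ℕ := (O.signature.map ENat.toNat).lcm

/-- The rational function `f` is a covering map `O₁ → O₂` between orbifolds on the sphere:
it is nonconstant and `ν₂ (f z) = ν₁ z * deg_z f` for all `z`. The equation gives
`f ⁻¹' {ν₂ = ∞} = {ν₁ = ∞}`, so that `f`, being a branched covering of the sphere by itself,
restricts to a branched covering between the complements of these sets. -/
def IsCovering (f : RatFunc ℂ) (O₁ O₂ : Orbifold) : Prop :=
  1 ≤ degree f ∧ ∀ z, O₂.ν (toMap f z) = O₁.ν z * (localDegree f z : ℕ∞)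

/-- A Lattès map: a rational function of degree at least two that is a self-covering of an
orbifold of signature `(2,2,2,2)`, `(3,3,3)`, `(2,4,4)` or `(2,3,6)`. -/
def IsLattes (f : RatFunc ℂ) : Prop :=
  2 ≤ degree f ∧ ∃ O : Orbifold, IsCovering f O O ∧
    (O.signature = {2, 2, 2, 2} ∨ O.signature = {3, 3, 3} ∨
      O.signature = {2, 4, 4} ∨ O.signature = {2, 3, 6})

/-- `B` is an elementary transformation of `A`: `A = U ∘ V` and `B = V ∘ U` for some rational
functions `U` and `V` (compositions as self-maps of the sphere). -/
def IsElementaryTransformation (A B : RatFunc ℂ) : Prop :=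
  ∃ U V : RatFunc ℂ, toMap A = toMap U ∘ toMap V ∧ toMap B = toMap V ∘ toMap U

/-- `A ∼ B`: there is a chain of elementary transformations between `A` and `B`. -/
def Equivalent (A B : RatFunc ℂ) : Prop :=
  Relation.ReflTransGen IsElementaryTransformation A B

end LattesMap

end

/-! Suppose `A = U ∘ V` is a self-covering of `O`. Setting `ν' (V z) = ν z * deg_z V` is
unambiguous, because multiplying by the local degree of `U` gives `ν (A z)`, which depends only on
`V z`. So `V : O → O'` and `U : O' → O` are coverings, and `V ∘ U` covers `O'` by itself
(`exists_intermediate`). For signature `(2,2,2,2)` the values of `ν'` are at most 2. The bound of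
`2m - 2` critical points, the half of Riemann–Hurwitz that is needed, gives at most four singular
points when applied to `V` and at least four when applied to `U` (`exists_of_elementary`). Along a
chain, `T` is a composition of such factors, each of degree dividing `d`.

Uniqueness (`eq_of_self`): the set where two self-covered orbifolds differ is finite and completely
invariant, so `f` is totally ramified on it; there `ν` grows by the factor `deg f` at each step,
which is impossible for finite values.

Chain rule and multiplicativity of degree come from pulling back binary forms (`substForm_spec`),
which treats `∞` like any other point. -/

namespace LattesMap

open Polynomial

/-! ### Zeros of binary forms on the sphere -/

/-- The order of vanishing at a point of the sphere of a polynomial `p`, regarded as a binary form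
of degree `n`. -/
noncomputable def formOrder (n : ℕ) (p : ℂ[X]) : Sphere → ℕ
  | some z => p.rootMultiplicity z
  | none => n - p.natDegree

@[simp] lemma formOrder_coe (n : ℕ) (p : ℂ[X]) (z : ℂ) :
    formOrder n p (z : Sphere) = p.rootMultiplicity z := rfl

@[simp] lemma formOrder_infty (n : ℕ) (p : ℂ[X]) : formOrder n p ∞ = n - p.natDegree := rfl

lemma formOrder_mul {m n : ℕ} {p q : ℂ[X]} (hp : p ≠ 0) (hq : q ≠ 0) (hm : p.natDegree ≤ m)
    (hn : q.natDegree ≤ n) (z : Sphere) :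
    formOrder (m + n) (p * q) z = formOrder m p z + formOrder n q z := by
  induction z using OnePoint.rec with
  | infty => simp [natDegree_mul hp hq]; omega
  | coe z => simp [rootMultiplicity_mul (mul_ne_zero hp hq)]

lemma formOrder_C_mul (n : ℕ) {c : ℂ} (hc : c ≠ 0) (p : ℂ[X]) (z : Sphere) :
    formOrder n (C c * p) z = formOrder n p z := by
  by_cases hp : p = 0
  · simp [hp]
  have := formOrder_mul (m := 0) (n := max n p.natDegree) (C_ne_zero.2 hc) hp (by simp)
    (le_max_right _ _) z
  induction z using OnePoint.rec with
  | infty => simp [natDegree_C_mul hc]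
  | coe z => simpa using this

/-- The number of zeros of a binary form is its degree. -/
lemma sum_formOrder {n : ℕ} {p : ℂ[X]} (hp : p ≠ 0) (hn : p.natDegree ≤ n) {F : Finset Sphere}
    (hF : ∀ z, 0 < formOrder n p z → z ∈ F) : ∑ z ∈ F, formOrder n p z = n := by
  classical
  have hroots : ∑ z ∈ p.roots.toFinset, p.rootMultiplicity z = p.natDegree := by
    have h := Multiset.toFinset_sum_count_eq p.roots
    simp only [count_roots] at h
    rw [h]
    exact (IsAlgClosed.splits p).natDegree_eq_card_roots.symm
  set G : Finset Sphere := insert ∞ (p.roots.toFinset.map ⟨_, OnePoint.coe_injective⟩) with hG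
  have hsum : ∑ z ∈ G, formOrder n p z = n := by
    rw [hG, Finset.sum_insert (by simp), Finset.sum_map]
    simp only [Function.Embedding.coeFn_mk, formOrder_coe, formOrder_infty]
    omega
  have hGs : ∀ z, 0 < formOrder n p z → z ∈ G := by
    intro z hz
    induction z using OnePoint.rec with
    | infty => simp [hG]
    | coe z =>
      rw [formOrder_coe, rootMultiplicity_pos hp] at hz
      simp [hG, hp]
      exact hz
  refine Eq.trans ?_ hsum
  rw [← Finset.sum_subset (s₁ := F ∩ G) Finset.inter_subset_left,
    ← Finset.sum_subset (s₁ := F ∩ G) Finset.inter_subset_right]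
  · intro z hz hz'
    by_contra h
    exact hz' (Finset.mem_inter.2 ⟨hF z (Nat.pos_of_ne_zero h), hz⟩)
  · intro z hz hz'
    by_contra h
    exact hz' (Finset.mem_inter.2 ⟨hz, hGs z (Nat.pos_of_ne_zero h)⟩)

/-! ### Fibers and local degrees -/

section Fiber

variable (f : RatFunc ℂ)

lemma natDegree_num_le : f.num.natDegree ≤ degree f := le_max_left _ _

lemma natDegree_denom_le : f.denom.natDegree ≤ degree f := le_max_right _ _

@[simp] lemma fiberPoly_coe (w : ℂ) : fiberPoly f (w : Sphere) = f.num - C w * f.denom := rfl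

@[simp] lemma fiberPoly_infty : fiberPoly f ∞ = f.denom := rfl

lemma natDegree_fiberPoly_le (w : Sphere) : (fiberPoly f w).natDegree ≤ degree f := by
  induction w using OnePoint.rec with
  | infty => exact natDegree_denom_le f
  | coe w =>
    refine (natDegree_sub_le _ _).trans (max_le (natDegree_num_le f) ?_)
    exact (natDegree_C_mul_le _ _).trans (natDegree_denom_le f)

variable {f}

lemma fiberPoly_ne_zero (hf : 1 ≤ degree f) (w : Sphere) : fiberPoly f w ≠ 0 := by
  induction w using OnePoint.rec with
  | infty => exact f.denom_ne_zero
  | coe w =>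
    intro h
    rw [fiberPoly_coe, sub_eq_zero] at h
    have hu : IsUnit f.denom :=
      f.isCoprime_num_denom.isUnit_of_dvd' (h ▸ dvd_mul_left _ _) dvd_rfl
    have hd := natDegree_eq_zero_of_isUnit hu
    have hn : f.num.natDegree = 0 := by
      rw [h]
      have := natDegree_C_mul_le w f.denom
      omega
    simp [degree, hd, hn] at hf

lemma eval_num_ne_zero {z : ℂ} (h : f.denom.eval z = 0) : f.num.eval z ≠ 0 := by
  intro h'
  obtain ⟨a, b, hab⟩ := f.isCoprime_num_denom
  simpa [h, h'] using congrArg (eval z) hab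

lemma coeff_num_ne_zero (h : f.denom.coeff (degree f) = 0) : f.num.coeff (degree f) ≠ 0 := by
  intro h'
  rcases max_choice f.num.natDegree f.denom.natDegree with hd | hd
  · have hd' : degree f = f.num.natDegree := hd
    rw [hd', coeff_natDegree, leadingCoeff_eq_zero] at h'
    rw [h', natDegree_zero] at hd'
    have : f = 0 := RatFunc.num_eq_zero_iff.1 h'
    subst this
    simp [degree] at h
  · have hd' : degree f = f.denom.natDegree := hd
    rw [hd', coeff_natDegree, leadingCoeff_eq_zero] at h
    exact f.denom_ne_zero h

lemma toMap_coe (z : ℂ) : toMap f (z : Sphere) =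
    if f.denom.eval z = 0 then ∞ else ((f.num.eval z / f.denom.eval z : ℂ) : Sphere) := by
  simp only [toMap]

lemma toMap_infty : toMap f ∞ = if f.denom.coeff (degree f) = 0 then ∞
    else ((f.num.coeff (degree f) / f.denom.coeff (degree f) : ℂ) : Sphere) := by
  simp only [toMap]

/-- Reduces the case distinctions in `toMap` to zeros of one form of degree `degree f`; a zero at
`∞` is the vanishing of the top coefficient. -/
lemma toMap_eq_iff (hf : 1 ≤ degree f) (z w : Sphere) :
    toMap f z = w ↔ 0 < formOrder (degree f) (fiberPoly f w) z := by
  induction z using OnePoint.rec with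
  | infty =>
    have hlt : 0 < formOrder (degree f) (fiberPoly f w) ∞ ↔
        (fiberPoly f w).coeff (degree f) = 0 := by
      rw [formOrder_infty, Nat.sub_pos_iff_lt]
      refine ⟨coeff_eq_zero_of_natDegree_lt, fun h => ?_⟩
      refine (natDegree_fiberPoly_le f w).lt_of_ne fun h' => fiberPoly_ne_zero hf w ?_
      rwa [← h', coeff_natDegree, leadingCoeff_eq_zero] at h
    rw [hlt, toMap_infty]
    have hnum := coeff_num_ne_zero (f := f)
    induction w using OnePoint.rec with
    | infty => split_ifs with h <;> simp [h]
    | coe w =>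
      split_ifs with h
      · simp [h, hnum h]
      · simp [sub_eq_zero, div_eq_iff h]
  | coe z =>
    rw [formOrder_coe, rootMultiplicity_pos (fiberPoly_ne_zero hf w), IsRoot.def, toMap_coe]
    have hnum := eval_num_ne_zero (f := f) (z := z)
    induction w using OnePoint.rec with
    | infty => split_ifs with h <;> simp [h]
    | coe w =>
      split_ifs with h
      · simp [h, hnum h]
      · simp [sub_eq_zero, div_eq_iff h]

lemma localDegree_eq (z : Sphere) :
    localDegree f z = formOrder (degree f) (fiberPoly f (toMap f z)) z := by
  induction z using OnePoint.rec <;> rfl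

lemma localDegree_pos (hf : 1 ≤ degree f) (z : Sphere) : 0 < localDegree f z := by
  rw [localDegree_eq, ← toMap_eq_iff hf]

open Classical in
lemma formOrder_fiberPoly (hf : 1 ≤ degree f) (z w : Sphere) :
    formOrder (degree f) (fiberPoly f w) z = if toMap f z = w then localDegree f z else 0 := by
  split_ifs with h
  · rw [localDegree_eq, h]
  · rwa [toMap_eq_iff hf, Nat.pos_iff_ne_zero, not_not] at h

lemma finite_fiber (hf : 1 ≤ degree f) (w : Sphere) : (toMap f ⁻¹' {w}).Finite := by
  refine ((((fiberPoly f w).roots.toFinset.finite_toSet).image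
    ((↑) : ℂ → Sphere)).insert ∞).subset ?_
  intro z hz
  rw [Set.mem_preimage, Set.mem_singleton_iff, toMap_eq_iff hf] at hz
  induction z using OnePoint.rec with
  | infty => simp
  | coe z =>
    right
    rw [formOrder_coe, rootMultiplicity_pos (fiberPoly_ne_zero hf w)] at hz
    exact ⟨z, by simpa [fiberPoly_ne_zero hf w] using hz, rfl⟩

lemma finite_preimage (hf : 1 ≤ degree f) {S : Set Sphere} (hS : S.Finite) :
    (toMap f ⁻¹' S).Finite :=
  hS.preimage' fun w _ => finite_fiber hf w

/-- A nonconstant rational function takes every value `degree f` times. -/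
lemma sum_localDegree_fiber (hf : 1 ≤ degree f) (w : Sphere) :
    ∑ z ∈ (finite_fiber hf w).toFinset, localDegree f z = degree f := by
  classical
  rw [← sum_formOrder (F := (finite_fiber hf w).toFinset) (fiberPoly_ne_zero hf w)
    (natDegree_fiberPoly_le f w)]
  · refine Finset.sum_congr rfl fun z hz => ?_
    rw [formOrder_fiberPoly hf, if_pos (by simpa using hz)]
  · intro z hz
    simpa [toMap_eq_iff hf] using hz

lemma sum_localDegree_preimage (hf : 1 ≤ degree f) {S : Set Sphere} (hS : S.Finite) :
    ∑ z ∈ (finite_preimage hf hS).toFinset, localDegree f z = hS.toFinset.card * degree f := by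
  classical
  rw [← Finset.sum_fiberwise_of_maps_to (t := hS.toFinset) (g := toMap f)
    (fun z hz => by simpa using hz)]
  rw [Finset.sum_congr rfl fun w hw => ?_, Finset.sum_const, smul_eq_mul]
  rw [← sum_localDegree_fiber hf w]
  refine Finset.sum_congr ?_ fun _ _ => rfl
  ext z
  simp only [Finset.mem_filter, Set.Finite.mem_toFinset, Set.mem_preimage,
    Set.mem_singleton_iff] at hw ⊢
  exact ⟨fun h => h.2, fun h => ⟨h ▸ hw, h⟩⟩

lemma toMap_surjective (hf : 1 ≤ degree f) : Function.Surjective (toMap f) := by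
  intro w
  by_contra! h
  have hs := sum_localDegree_fiber hf w
  rw [Finset.sum_eq_zero] at hs
  · omega
  · intro z hz
    exact absurd (by simpa using hz) (h z)

lemma toMap_eq_of_degree_eq_zero (hf : degree f = 0) (z w : Sphere) : toMap f z = toMap f w := by
  have hn : f.num.natDegree = 0 := by have := natDegree_num_le f; omega
  have hd : f.denom.natDegree = 0 := by have := natDegree_denom_le f; omega
  have key : ∀ z, toMap f z = if f.denom.coeff 0 = 0 then ∞
      else ((f.num.coeff 0 / f.denom.coeff 0 : ℂ) : Sphere) := by
    intro z
    induction z using OnePoint.rec with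
    | infty => rw [toMap_infty, hf]
    | coe z =>
      rw [toMap_coe]
      rw [eq_C_of_natDegree_eq_zero hn, eq_C_of_natDegree_eq_zero hd]
      simp
  rw [key, key w]

/-- The cross-multiplied polynomials agree off the finitely many finite poles. -/
lemma eq_of_toMap_eq {g : RatFunc ℂ} (h : toMap f = toMap g) : f = g := by
  have key : f.num * g.denom = g.num * f.denom := by
    refine eq_of_infinite_eval_eq _ _ ?_
    refine Set.Infinite.mono (s := {z | (f.denom * g.denom).IsRoot z}ᶜ) ?_
      (finite_setOfPred_isRoot (mul_ne_zero f.denom_ne_zero g.denom_ne_zero)).infinite_compl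
    intro z hz
    simp only [Set.mem_compl_iff, Set.mem_ofPred_eq, IsRoot.def, eval_mul, mul_eq_zero,
      not_or] at hz
    have := congrFun h (z : Sphere)
    rw [toMap_coe, toMap_coe, if_neg hz.1, if_neg hz.2, OnePoint.coe_eq_coe,
      div_eq_div_iff hz.1 hz.2] at this
    simpa using this
  rwa [RatFunc.num_mul_eq_mul_denom_iff g.denom_ne_zero, RatFunc.num_div_denom] at key

end Fiber

/-! ### Composition and the chain rule -/

section Composition

/-- The value of the binary form of degree `m` attached to `p` at the pair consisting of the
numerator and the denominator of `g`. -/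
noncomputable def substForm (g : RatFunc ℂ) (m : ℕ) (p : ℂ[X]) : ℂ[X] :=
  MvPolynomial.aeval ![g.num, g.denom] (p.homogenize m)

variable {f g : RatFunc ℂ}

lemma substForm_sub_C_mul (m : ℕ) (p q : ℂ[X]) (c : ℂ) :
    substForm g m (p - C c * q) = substForm g m p - C c * substForm g m q := by
  simp only [substForm, homogenize_sub, homogenize_C_mul, map_sub, map_mul, MvPolynomial.aeval_C]
  rfl

lemma substForm_C (m : ℕ) (c : ℂ) : substForm g m (C c) = C c * g.denom ^ m := by
  simp only [substForm, homogenize_C, map_mul, MvPolynomial.aeval_C, map_pow,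
    MvPolynomial.aeval_X]
  rfl

lemma substForm_X_sub_C (a : ℂ) : substForm g 1 (X - C a) = fiberPoly g (a : Sphere) := by
  have := substForm_sub_C_mul (g := g) 1 X 1 a
  rw [mul_one] at this
  rw [this, fiberPoly_coe]
  simp [substForm]

lemma substForm_mul {m n : ℕ} {p q : ℂ[X]} (hm : p.natDegree ≤ m) (hn : q.natDegree ≤ n) :
    substForm g (m + n) (p * q) = substForm g m p * substForm g n q := by
  simp only [substForm, homogenize_mul p q hm hn, map_mul]

lemma formOrder_pow (n m : ℕ) (p : ℂ[X]) (z : Sphere) :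
    formOrder (m * n) (p ^ m) z = m * formOrder n p z := by
  induction z using OnePoint.rec with
  | infty => simp [natDegree_pow, Nat.mul_sub]
  | coe z => simp [← count_roots, roots_pow]

/-- The order of vanishing of a form pulled back by a rational function. -/
lemma substForm_spec (hg : 1 ≤ degree g) {m : ℕ} {p : ℂ[X]} (hp : p ≠ 0) (hm : p.natDegree ≤ m) :
    substForm g m p ≠ 0 ∧ (substForm g m p).natDegree ≤ m * degree g ∧
      ∀ z, formOrder (m * degree g) (substForm g m p) z =
        formOrder m p (toMap g z) * localDegree g z := by
  classical
  -- Split off linear factors: `X - C a` pulls back to the fiber form over `a`. A constant, as a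
  -- form of degree `m`, vanishes to order `m` at `∞` and pulls back to a multiple of `g.denom ^ m`.
  induction hk : p.natDegree generalizing m p with
  | zero =>
    obtain ⟨c, rfl⟩ := natDegree_eq_zero.1 hk
    have hc : c ≠ 0 := by rintro rfl; simp at hp
    rw [substForm_C]
    refine ⟨mul_ne_zero hp (pow_ne_zero _ g.denom_ne_zero), ?_, fun z => ?_⟩
    · rw [natDegree_C_mul hc, natDegree_pow]
      exact Nat.mul_le_mul_left _ (natDegree_denom_le g)
    · rw [formOrder_C_mul _ hc, formOrder_pow, ← fiberPoly_infty, formOrder_fiberPoly hg]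
      cases h : toMap g z using OnePoint.rec with
      | infty => simp
      | coe w => simp
  | succ k ih =>
    obtain ⟨a, ha⟩ := IsAlgClosed.exists_root p (by
      intro h
      have := natDegree_eq_zero_iff_degree_le_zero.2 h.le
      omega)
    obtain ⟨q, rfl⟩ := dvd_iff_isRoot.2 ha
    have hq : q ≠ 0 := right_ne_zero_of_mul hp
    have hX : (X - C a : ℂ[X]) ≠ 0 := X_sub_C_ne_zero a
    rw [natDegree_mul hX hq, natDegree_X_sub_C] at hk hm
    obtain ⟨n, rfl⟩ : ∃ n, m = 1 + n := ⟨m - 1, by omega⟩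
    have hqn : q.natDegree ≤ n := by omega
    obtain ⟨h1, h2, h3⟩ := ih hq hqn (by omega)
    have hF := fiberPoly_ne_zero hg (a : Sphere)
    have hFd := natDegree_fiberPoly_le g (a : Sphere)
    rw [substForm_mul (natDegree_X_sub_C a).le hqn, substForm_X_sub_C]
    refine ⟨mul_ne_zero hF h1, ?_, fun z => ?_⟩
    · rw [natDegree_mul hF h1, Nat.add_mul, one_mul]
      omega
    · rw [Nat.add_mul, one_mul, formOrder_mul hF h1 hFd h2, h3,
        formOrder_mul hX hq (natDegree_X_sub_C a).le hqn, Nat.add_mul, formOrder_fiberPoly hg]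
      congr 1
      cases h : toMap g z using OnePoint.rec with
      | infty => simp
      | coe w => simp [rootMultiplicity_X_sub_C]

lemma exists_num_denom_eq {p q : ℂ[X]} (hq : q ≠ 0) (h : IsCoprime p q) :
    ∃ (r : RatFunc ℂ) (c : ℂ), c ≠ 0 ∧ r.num = C c * p ∧ r.denom = C c * q := by
  set r : RatFunc ℂ := algebraMap _ _ p / algebraMap _ _ q with hr
  have key := (RatFunc.num_mul_eq_mul_denom_iff hq).2 hr
  have h1 : r.denom ∣ q := r.isCoprime_num_denom.symm.dvd_of_dvd_mul_left
    (key ▸ dvd_mul_left _ _)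
  have h2 : q ∣ r.denom := h.symm.dvd_of_dvd_mul_left (key ▸ dvd_mul_left _ _)
  obtain ⟨u, hu⟩ := associated_of_dvd_dvd h2 h1
  obtain ⟨c, hc, hcu⟩ := isUnit_iff.1 u.isUnit
  refine ⟨r, c, hc.ne_zero, ?_, ?_⟩
  · rw [← hu, ← hcu] at key
    refine mul_right_cancel₀ hq (key.trans ?_)
    ring
  · rw [← hu, ← hcu, mul_comm]

/-- The pullbacks along `g` of the two forms defining `f` have no common zero, so nothing cancels
and the degrees multiply. Fiber forms of the composite are pullbacks of those of `f`, whence the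
chain rule. -/
lemma exists_comp (hf : 1 ≤ degree f) (hg : 1 ≤ degree g) :
    ∃ h : RatFunc ℂ, degree h = degree f * degree g ∧ toMap h = toMap f ∘ toMap g ∧
      ∀ z, localDegree h z = localDegree f (toMap g z) * localDegree g z := by
  classical
  have spec := fun w => substForm_spec hg (fiberPoly_ne_zero hf w) (natDegree_fiberPoly_le f w)
  have hP := spec ((0 : ℂ) : Sphere)
  have hQ := spec ∞
  simp only [fiberPoly_coe, C_0, zero_mul, sub_zero, fiberPoly_infty] at hP hQ
  set P := substForm g (degree f) f.num
  set Q := substForm g (degree f) f.denom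
  -- A common zero would make `f (g z)` both `0` and `∞`.
  have hdisj : ∀ z, formOrder (degree f * degree g) P z = 0 ∨
      formOrder (degree f * degree g) Q z = 0 := by
    intro z
    have h0 := formOrder_fiberPoly hf (toMap g z) ((0 : ℂ) : Sphere)
    have h1 := formOrder_fiberPoly hf (toMap g z) ∞
    simp only [fiberPoly_coe, C_0, zero_mul, sub_zero, fiberPoly_infty] at h0 h1
    rw [hP.2.2, hQ.2.2, h0, h1]
    by_cases h : toMap f (toMap g z) = ∞ <;> simp [h]
  have hcop : IsCoprime P Q := by
    refine isCoprime_of_irreducible_dvd (fun h => hQ.1 h.2) fun r hr hrP hrQ => ?_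
    obtain ⟨z, hz⟩ := IsAlgClosed.exists_root r
      (by rintro h0; exact hr.not_isUnit (isUnit_iff_degree_eq_zero.2 h0))
    rcases hdisj (z : Sphere) with h | h
    · exact ((rootMultiplicity_pos hP.1).2 (hz.dvd hrP)).ne' h
    · exact ((rootMultiplicity_pos hQ.1).2 (hz.dvd hrQ)).ne' h
  obtain ⟨h, c, hc, hn, hd⟩ := exists_num_denom_eq hQ.1 hcop
  have hdeg : degree h = degree f * degree g := by
    rw [degree, hn, hd, natDegree_C_mul hc, natDegree_C_mul hc]
    refine le_antisymm (max_le hP.2.1 hQ.2.1) ?_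
    rcases hdisj ∞ with h | h
    · exact le_max_of_le_left (Nat.sub_eq_zero_iff_le.1 h)
    · exact le_max_of_le_right (Nat.sub_eq_zero_iff_le.1 h)
  have hfib : ∀ w, fiberPoly h w = C c * substForm g (degree f) (fiberPoly f w) := by
    intro w
    induction w using OnePoint.rec with
    | infty => exact hd
    | coe w => rw [fiberPoly_coe, fiberPoly_coe, substForm_sub_C_mul, hn, hd]; ring
  have hdeg1 : 1 ≤ degree h := hdeg ▸ Nat.mul_le_mul hf hg
  have hord : ∀ w z, formOrder (degree h) (fiberPoly h w) z =
      formOrder (degree f) (fiberPoly f w) (toMap g z) * localDegree g z := by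
    intro w z
    rw [hfib, formOrder_C_mul _ hc, hdeg, (spec w).2.2]
  have hmap : toMap h = toMap f ∘ toMap g := by
    ext1 z
    rw [toMap_eq_iff hdeg1, hord]
    refine Nat.mul_pos ((toMap_eq_iff hf _ _).1 rfl) (localDegree_pos hg z)
  refine ⟨h, hdeg, hmap, fun z => ?_⟩
  rw [localDegree_eq, hord, hmap, localDegree_eq (f := f)]
  rfl

/-- The degree is multiplicative and the local degree satisfies the chain rule. -/
lemma degree_localDegree_of_comp {h : RatFunc ℂ} (hh : 1 ≤ degree h)
    (hcomp : toMap h = toMap f ∘ toMap g) :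
    1 ≤ degree f ∧ 1 ≤ degree g ∧ degree h = degree f * degree g ∧
      ∀ z, localDegree h z = localDegree f (toMap g z) * localDegree g z := by
  have hne : ((0 : ℂ) : Sphere) ≠ ∞ := OnePoint.coe_ne_infty _
  have hconst : ∀ c, ¬ ∀ z, toMap h z = c := fun c hc => by
    obtain ⟨x, hx⟩ := toMap_surjective hh ((0 : ℂ) : Sphere)
    obtain ⟨y, hy⟩ := toMap_surjective hh ∞
    exact hne (by rw [← hx, ← hy, hc x, hc y])
  have hf : 1 ≤ degree f := by
    by_contra! h0
    refine hconst (toMap f ∞) fun z => ?_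
    rw [hcomp]
    exact toMap_eq_of_degree_eq_zero (by omega) _ _
  have hg : 1 ≤ degree g := by
    by_contra! h0
    refine hconst (toMap f (toMap g ∞)) fun z => ?_
    rw [hcomp, Function.comp_apply, toMap_eq_of_degree_eq_zero (f := g) (by omega) z ∞]
  obtain ⟨k, hk1, hk2, hk3⟩ := exists_comp hf hg
  obtain rfl : h = k := eq_of_toMap_eq (hcomp.trans hk2.symm)
  exact ⟨hf, hg, hk1, hk3⟩

end Composition

/-! ### Critical points via the Wronskian -/

section Critical

variable {f : RatFunc ℂ}

lemma wronskian_num_denom_ne_zero (hf : 1 ≤ degree f) : wronskian f.num f.denom ≠ 0 := by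
  intro h
  obtain ⟨h1, h2⟩ := (f.isCoprime_num_denom.wronskian_eq_zero_iff).1 h
  have h1 := derivative_eq_zero.1 h1
  have h2 := derivative_eq_zero.1 h2
  simp [degree, h1, h2] at hf

lemma wronskian_fiberPoly_coe (w : ℂ) :
    wronskian (fiberPoly f (w : Sphere)) f.denom = wronskian f.num f.denom := by
  simp only [wronskian, fiberPoly_coe, derivative_sub, derivative_C_mul]
  ring

/-- The contribution of `∞`: subtracting `f ∞` times the denominator leaves the Wronskian unchanged
and lowers the numerator's degree by the order of contact at `∞`. -/
lemma natDegree_wronskian_add_localDegree_lt (hf : 1 ≤ degree f) :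
    (wronskian f.num f.denom).natDegree + localDegree f ∞ < 2 * degree f := by
  have hw := wronskian_num_denom_ne_zero hf
  rw [localDegree_eq, formOrder_infty]
  have hle := natDegree_fiberPoly_le f (toMap f ∞)
  suffices (wronskian f.num f.denom).natDegree < degree f +
      (fiberPoly f (toMap f ∞)).natDegree by omega
  cases h : toMap f ∞ using OnePoint.rec with
  | infty =>
    exact (natDegree_wronskian_lt_add hw).trans_le (Nat.add_le_add_right (natDegree_num_le f) _)
  | coe w =>
    rw [← wronskian_fiberPoly_coe w] at hw ⊢
    rw [add_comm]
    exact (natDegree_wronskian_lt_add hw).trans_le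
      (Nat.add_le_add_left (natDegree_denom_le f) _)

lemma isRoot_wronskian_of_two_le_localDegree {z : ℂ} (hf : 1 ≤ degree f)
    (hz : 2 ≤ localDegree f (z : Sphere)) : (wronskian f.num f.denom).IsRoot z := by
  rw [localDegree_eq, formOrder_coe] at hz
  have hR := (one_lt_rootMultiplicity_iff_isRoot (fiberPoly_ne_zero hf _)).1 hz
  cases h : toMap f (z : Sphere) using OnePoint.rec with
  | infty =>
    rw [h] at hR
    have h1 : f.denom.eval z = 0 := hR.1
    have h2 : (derivative f.denom).eval z = 0 := hR.2
    simp [wronskian, h1, h2]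
  | coe w =>
    rw [h] at hR
    rw [← wronskian_fiberPoly_coe w, wronskian, IsRoot.def, eval_sub, eval_mul, eval_mul,
      hR.1.eq_zero, hR.2.eq_zero]
    simp

/-- A rational function of degree `m` has at most `2 * m - 2` critical points. -/
lemma card_critical_add_two_le (hf : 1 ≤ degree f) (F : Finset Sphere)
    (hF : ∀ z ∈ F, 2 ≤ localDegree f z) : F.card + 2 ≤ 2 * degree f := by
  classical
  have hlt := natDegree_wronskian_add_localDegree_lt hf
  set W := wronskian f.num f.denom with hW
  have hpos := localDegree_pos hf ∞
  have hsub : F.erase ∞ ⊆ W.roots.toFinset.image (↑) := by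
    intro z hz
    obtain ⟨hz0, hzF⟩ := Finset.mem_erase.1 hz
    induction z using OnePoint.rec with
    | infty => exact absurd rfl hz0
    | coe z =>
      refine Finset.mem_image_of_mem _ ?_
      rw [Multiset.mem_toFinset, mem_roots (wronskian_num_denom_ne_zero hf)]
      exact isRoot_wronskian_of_two_le_localDegree hf (hF _ hzF)
  have hcard : (F.erase ∞).card ≤ W.natDegree :=
    (Finset.card_le_card hsub).trans <| Finset.card_image_le.trans <|
      (Multiset.toFinset_card_le _).trans (card_roots' W)
  -- If `∞` is critical, its local degree of at least 2 in `hlt` costs the Wronskian one more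
  -- degree, which pays for this extra point.
  by_cases h : ∞ ∈ F
  · have := hF _ h
    rw [Finset.card_erase_of_mem h] at hcard
    omega
  · rw [Finset.erase_eq_of_notMem h] at hcard
    omega

end Critical

/-! ### Orbifolds of signature (2,2,2,2) -/

namespace Orbifold

/-- The finite set of singular points of an orbifold. -/
noncomputable def singular (O : Orbifold) : Finset Sphere := O.finite_singular.toFinset

lemma mem_singular {O : Orbifold} {z : Sphere} : z ∈ O.singular ↔ 1 < O.ν z := by
  simp [singular]

lemma signature_eq_iff {O : Orbifold} :
    O.signature = {2, 2, 2, 2} ↔ (∀ z, O.ν z ≤ 2) ∧ O.singular.card = 4 := by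
  constructor
  · intro h
    refine ⟨fun z => ?_, ?_⟩
    · by_contra! hz
      have : O.ν z ∈ O.signature :=
        Multiset.mem_map_of_mem _ (mem_singular.2 (lt_trans (by norm_num) hz))
      rw [h] at this
      simp only [Multiset.insert_eq_cons, Multiset.mem_cons, Multiset.mem_singleton,
        or_self] at this
      exact hz.ne' this
    · simpa [signature, singular] using congrArg Multiset.card h
  · rintro ⟨h2, h4⟩
    have : O.signature = Multiset.replicate 4 2 := by
      rw [Multiset.eq_replicate]
      refine ⟨by rw [signature, Multiset.card_map]; exact h4, fun b hb => ?_⟩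
      obtain ⟨z, hz, rfl⟩ := Multiset.mem_map.1 hb
      refine le_antisymm (h2 z) ?_
      have h1 : 1 < O.ν z := mem_singular.1 hz
      exact Order.add_one_le_of_lt h1
    rw [this]
    rfl

lemma ne_top_of_forall_le_two {O : Orbifold} (h : ∀ z, O.ν z ≤ 2) (z : Sphere) : O.ν z ≠ ⊤ :=
  ((h z).trans_lt (by exact_mod_cast ENat.natCast_lt_top 2)).ne

lemma l_eq_two_of_signature_eq {O : Orbifold} (h : O.signature = {2, 2, 2, 2}) : O.l = 2 := by
  rw [l, h]
  simp only [Multiset.insert_eq_cons, Multiset.map_cons, Multiset.map_singleton]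
  decide

lemma ne_top_of_notMem_signature {O : Orbifold} (h : ⊤ ∉ O.signature) (z : Sphere) :
    O.ν z ≠ ⊤ := fun hz => h <| hz ▸ Multiset.mem_map_of_mem _ (mem_singular.2 (by simp [hz]))

end Orbifold

/-! ### Coverings between orbifolds -/

namespace IsCovering

variable {f : RatFunc ℂ} {O O₁ O₂ O₃ : Orbifold}

lemma exists_comp {g : RatFunc ℂ} (hf : IsCovering f O₂ O₃) (hg : IsCovering g O₁ O₂) :
    ∃ h, degree h = degree f * degree g ∧ toMap h = toMap f ∘ toMap g ∧ IsCovering h O₁ O₃ := by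
  obtain ⟨h, h1, h2, h3⟩ := LattesMap.exists_comp hf.1 hg.1
  refine ⟨h, h1, h2, h1 ▸ Nat.mul_le_mul hf.1 hg.1, fun z => ?_⟩
  rw [h2, h3, Function.comp_apply, hf.2, hg.2, mul_assoc, mul_comm (localDegree f _), Nat.cast_mul]

/-- A rational function of degree at least two is a self-covering of at most one orbifold, once
it is one of an orbifold without infinite values. -/
lemma eq_of_self (hO : IsCovering f O O) (hd : 2 ≤ degree f) (htop : ∀ z, O.ν z ≠ ⊤)
    (h₁ : IsCovering f O₁ O₁) : O₁ = O := by
  classical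
  have hbad : {z | O₁.ν z ≠ O.ν z}.Finite := by
    refine (O₁.finite_singular.union O.finite_singular).subset fun z hz => ?_
    by_contra h
    rw [Set.mem_union, not_or] at h
    have h1 := le_antisymm (not_lt.1 h.1) (O₁.one_le z)
    have h2 := le_antisymm (not_lt.1 h.2) (O.one_le z)
    exact hz (h1.trans h2.symm)
  set P := (finite_preimage hO.1 hbad).toFinset with hP
  -- Agreement at `z` propagates to `f z`, so the preimage of the bad set lies in it; surjectivity
  -- and counting then force equality and injectivity.
  have hPsub : P ⊆ hbad.toFinset := by
    intro z hz
    simp only [hP, Set.Finite.mem_toFinset, Set.mem_preimage, Set.mem_ofPred_eq] at hz ⊢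
    intro h
    rw [hO.2, h₁.2, h] at hz
    exact hz rfl
  have himage : P.image (toMap f) = hbad.toFinset := by
    ext w
    simp only [hP, Finset.mem_image, Set.Finite.mem_toFinset, Set.mem_preimage]
    refine ⟨?_, fun hw => ?_⟩
    · rintro ⟨z, hz, rfl⟩
      exact hz
    · obtain ⟨z, rfl⟩ := toMap_surjective hO.1 w
      exact ⟨z, hw, rfl⟩
  have hcard : hbad.toFinset.card ≤ P.card := himage ▸ Finset.card_image_le
  have hPeq : P = hbad.toFinset := Finset.eq_of_subset_of_card_le hPsub hcard
  have hinj : Set.InjOn (toMap f) P :=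
    Finset.card_image_iff.1 (by rw [himage, hPeq])
  have hram : ∀ z ∈ P, localDegree f z = degree f := by
    intro z hz
    rw [← sum_localDegree_fiber hO.1 (toMap f z)]
    symm
    refine Finset.sum_eq_single_of_mem z (by simp) fun y hy hyz => absurd ?_ hyz
    have hy' : toMap f y = toMap f z := by simpa using hy
    refine hinj ?_ hz hy'
    simp only [hP, Finset.mem_coe, Set.Finite.mem_toFinset, Set.mem_preimage] at hz ⊢
    rwa [hy']
  have hempty : P = ∅ := by
    by_contra hne
    -- At a maximum of `ν` on `P`, passing to `f z ∈ P` multiplies the finite value by `degree f ≥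
    -- 2`.
    obtain ⟨z, hz, hmax⟩ := Finset.exists_max_image P O.ν (Finset.nonempty_iff_ne_empty.2 hne)
    have hfz : toMap f z ∈ P := by
      rw [hPeq, ← himage]
      exact Finset.mem_image_of_mem _ hz
    have h := hmax _ hfz
    rw [hO.2, hram z hz] at h
    have h1 := O.one_le z
    obtain ⟨n, hn⟩ := ENat.ne_top_iff_exists.1 (htop z)
    rw [← hn] at h h1
    norm_cast at h h1
    nlinarith
  ext z
  by_contra hz
  have : z ∈ hbad.toFinset := by simpa using hz
  rw [← hPeq, hempty] at this
  simp at this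

/-- A consequence of the bound on the number of critical points: a covering map between orbifolds
with values at most two cannot decrease the Euler characteristic too much. -/
lemma degree_mul_card_singular_add_four_le (h : IsCovering f O₁ O₂) (h2 : ∀ z, O₂.ν z ≤ 2) :
    degree f * O₂.singular.card + 4 ≤ O₁.singular.card + 4 * degree f := by
  classical
  set P := (finite_preimage h.1 O₂.finite_singular).toFinset with hP
  have hsum : ∑ z ∈ P, localDegree f z = O₂.singular.card * degree f :=
    sum_localDegree_preimage h.1 O₂.finite_singular
  have hmem : ∀ z, z ∈ P ↔ 1 < O₁.ν z * (localDegree f z : ℕ∞) := by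
    intro z
    rw [← h.2]
    simp [hP]
  have hsub : O₁.singular ⊆ P := by
    intro z hz
    rw [hmem]
    refine (Orbifold.mem_singular.1 hz).trans_le (le_mul_of_one_le_right' ?_)
    exact_mod_cast localDegree_pos h.1 z
  -- On `P` the product of `O₁.ν z` and the local degree is exactly 2, so just one of the two
  -- factors is 2.
  have key : ∀ z ∈ P, localDegree f z = if z ∈ O₁.singular then 1 else 2 := by
    intro z hz
    rw [hmem] at hz
    have h2z := h2 (toMap f z)
    have hpos := localDegree_pos h.1 z
    have h1 := O₁.one_le z
    rw [h.2] at h2z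
    have hle : O₁.ν z ≤ 2 :=
      (le_mul_of_one_le_right' (by exact_mod_cast hpos)).trans h2z
    simp only [Orbifold.mem_singular]
    have hne : O₁.ν z ≠ ⊤ := (hle.trans_lt (by exact_mod_cast ENat.natCast_lt_top 2)).ne
    obtain ⟨n, hn⟩ := ENat.ne_top_iff_exists.1 hne
    rw [← hn] at hz h2z h1 hle ⊢
    norm_cast at hz h2z h1 hle ⊢
    split_ifs with h <;> nlinarith
  have hcrit := card_critical_add_two_le h.1 (P \ O₁.singular) fun z hz => by
    rw [Finset.mem_sdiff] at hz
    rw [key z hz.1, if_neg hz.2]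
  rw [← Finset.sum_sdiff hsub, Finset.sum_congr rfl fun z hz => key z (hsub hz),
    Finset.sum_congr rfl fun z hz => key z (Finset.mem_sdiff.1 hz).1,
    Finset.sum_congr rfl fun z hz => if_pos hz,
    Finset.sum_congr rfl fun z hz => if_neg (Finset.mem_sdiff.1 hz).2] at hsum
  simp only [Finset.sum_const, smul_eq_mul] at hsum
  rw [mul_comm (degree f)]
  omega

/-- A self-covering that is a composition factors through an intermediate orbifold. -/
lemma exists_intermediate {U V : RatFunc ℂ} (h : IsCovering f O O)
    (hf : toMap f = toMap U ∘ toMap V) : ∃ O', IsCovering V O O' ∧ IsCovering U O' O := by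
  obtain ⟨hU, hV, -, hloc⟩ := degree_localDegree_of_comp h.1 hf
  -- The section picks one preimage under `V` to define `ν'`; cancelling the local degree of `U` at
  -- the end shows that the choice is immaterial.
  obtain ⟨s, hs⟩ := (toMap_surjective hV).hasRightInverse
  have hcov : ∀ z, O.ν (toMap U (toMap V z)) =
      O.ν z * (localDegree V z : ℕ∞) * (localDegree U (toMap V z) : ℕ∞) := by
    intro z
    have := h.2 z
    rwa [hloc, hf, Function.comp_apply, Nat.cast_mul, mul_comm (localDegree U _ : ℕ∞),
      ← mul_assoc] at this
  have hsU : ∀ w, O.ν (toMap U w) =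
      O.ν (s w) * (localDegree V (s w) : ℕ∞) * (localDegree U w : ℕ∞) := by
    intro w
    have := hcov (s w)
    rwa [hs w] at this
  refine ⟨⟨fun w => O.ν (s w) * (localDegree V (s w) : ℕ∞), fun w => ?_, ?_⟩,
    ⟨hV, fun z => ?_⟩, ⟨hU, hsU⟩⟩
  · refine one_le_mul_of_one_le_of_one_le (O.one_le _) ?_
    exact_mod_cast localDegree_pos hV _
  · refine (finite_preimage hU O.finite_singular).subset fun w hw => ?_
    rw [Set.mem_preimage, Set.mem_ofPred_eq, hsU]
    refine lt_of_lt_of_le hw (le_mul_of_one_le_right' ?_)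
    exact_mod_cast localDegree_pos hU _
  · have h0 : (localDegree U (toMap V z) : ℕ∞) ≠ 0 := by
      exact_mod_cast (localDegree_pos hU _).ne'
    exact (ENat.mul_left_strictMono h0 (ENat.natCast_ne_top _)).injective ((hsU _).symm.trans (hcov z))

/-- Elementary transformations preserve self-coverings of orbifolds of signature `(2,2,2,2)`. -/
lemma exists_of_elementary {A B U V : RatFunc ℂ} (hA : IsCovering A O O)
    (hO : O.signature = {2, 2, 2, 2}) (hAUV : toMap A = toMap U ∘ toMap V)
    (hBVU : toMap B = toMap V ∘ toMap U) :
    ∃ O', O'.signature = {2, 2, 2, 2} ∧ IsCovering B O' O' ∧ IsCovering V O O' ∧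
      degree B = degree A ∧ degree V ∣ degree A := by
  obtain ⟨O', hV, hU⟩ := hA.exists_intermediate hAUV
  obtain ⟨h2, h4⟩ := Orbifold.signature_eq_iff.1 hO
  have h2' : ∀ z, O'.ν z ≤ 2 := fun w => by
    refine le_trans (le_mul_of_one_le_right' ?_) ((hU.2 w).symm.trans_le (h2 _))
    exact_mod_cast localDegree_pos hU.1 w
  have hdeg := (degree_localDegree_of_comp hA.1 hAUV).2.2.1
  have hcard : O'.singular.card = 4 := by
    have hle := hV.degree_mul_card_singular_add_four_le h2'
    have hge := hU.degree_mul_card_singular_add_four_le h2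
    rw [h4] at hle hge
    have := hV.1
    -- `U` gives at least four singular points; `V` gives at most four, after dividing by `degree
    -- V`.
    refine le_antisymm ?_ (by omega)
    by_contra! hlt
    have := Nat.mul_le_mul_left (degree V) hlt
    omega
  obtain ⟨B', hd, hm, hB⟩ := hV.exists_comp hU
  obtain rfl : B = B' := eq_of_toMap_eq (hBVU.trans hm.symm)
  exact ⟨O', Orbifold.signature_eq_iff.2 ⟨h2', hcard⟩, hB, hV, by rw [hd, hdeg, mul_comm],
    hdeg ▸ dvd_mul_left _ _⟩

end IsCovering

/-! ### The lemma on chains -/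

/-- For a Lattès map, a self-covered orbifold with `l = 2` has signature `(2,2,2,2)`. -/
lemma signature_eq_of_l_eq_two {A : RatFunc ℂ} (hA : IsLattes A) {O : Orbifold}
    (hO : IsCovering A O O) (hl : O.l = 2) : O.signature = {2, 2, 2, 2} := by
  obtain ⟨hd, O', hO', hsig⟩ := hA
  have htop : ∀ z, O'.ν z ≠ ⊤ := by
    refine Orbifold.ne_top_of_notMem_signature fun h => ?_
    rcases hsig with hs | hs | hs | hs <;> rw [hs] at h <;>
      simp only [Multiset.insert_eq_cons, Multiset.mem_cons, Multiset.mem_singleton] at h <;>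
      revert h <;> decide
  obtain rfl := hO'.eq_of_self hd htop hO
  have hl' : (O.signature.map ENat.toNat).lcm = 2 := hl
  rcases hsig with hs | hs | hs | hs
  · exact hs
  -- The other signatures have least common multiple 3, 4 and 6.
  all_goals
    rw [hs] at hl'
    simp only [Multiset.insert_eq_cons, Multiset.map_cons, Multiset.map_singleton] at hl'
    exact absurd hl' (by decide)

end LattesMap

theorem lemma4p1 (A B : RatFunc ℂ) (hA : LattesMap.IsLattes A)
    (OA : LattesMap.Orbifold) (hOA : LattesMap.IsCovering A OA OA) (hl : OA.l = 2)
    (hBA : LattesMap.Equivalent B A) :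
    LattesMap.IsLattes B ∧
      ∃ OB : LattesMap.Orbifold,
        LattesMap.IsCovering B OB OB ∧
        (∀ O : LattesMap.Orbifold, LattesMap.IsCovering B O O → O = OB) ∧
        OB.l = 2 ∧
        ∃ (T : RatFunc ℂ) (k : ℕ),
          LattesMap.degree T ∣ LattesMap.degree A ^ k ∧ LattesMap.IsCovering T OA OB := by
  open LattesMap in
  have hsig := signature_eq_of_l_eq_two hA hOA hl
  have key : degree B = degree A ∧ ∃ OB : Orbifold, OB.signature = {2, 2, 2, 2} ∧
      IsCovering B OB OB ∧ ∃ (T : RatFunc ℂ) (k : ℕ),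
        degree T ∣ degree A ^ k ∧ IsCovering T OA OB := by
    induction hBA using Relation.ReflTransGen.head_induction_on with
    -- `A` itself serves as `T` for the trivial chain.
    | refl => exact ⟨rfl, OA, hsig, hOA, A, 1, by simp, hOA⟩
    | head hBC _ ih =>
      obtain ⟨hd, OC, hs, hC, T, k, hT, hTc⟩ := ih
      obtain ⟨U, V, hB, hC'⟩ := hBC
      -- Here `B = U ∘ V` and `C = V ∘ U`, so the roles of `U` and `V` are exchanged: it is `U` that
      -- covers `OC → OB` and is composed with `T`.
      obtain ⟨OB, hsB, hBc, hU, hdB, hdvd⟩ := hC.exists_of_elementary hs hC' hB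
      obtain ⟨T', hT', -, hT'c⟩ := hU.exists_comp hTc
      refine ⟨hdB.trans hd, OB, hsB, hBc, T', k + 1, ?_, hT'c⟩
      rw [hT', pow_succ']
      exact mul_dvd_mul (hd ▸ hdvd) hT
  obtain ⟨hd, OB, hs, hB, hT⟩ := key
  have hd2 : 2 ≤ degree B := hd ▸ hA.1
  have htop := Orbifold.ne_top_of_forall_le_two (Orbifold.signature_eq_iff.1 hs).1
  exact ⟨⟨hd2, OB, hB, Or.inl hs⟩, OB, hB, fun O hO => hB.eq_of_self hd2 htop hO,
    Orbifold.l_eq_two_of_signature_eq hs, hT⟩
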